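/- Let $X_1,X_2,\ldots$ be i.i.d. with the Laplace density $f_\theta(x)=\tfrac12 e^{-|x-\theta|}$ on $\mathbb R$, let $P_\theta$ be the law of the sequence, and consider testing $H_0:\theta=0$ against $H_1:\theta>0$ with the following statistics, each rejecting for large values: the sign statistic $V_n=\sum_{i=1}^n\mathbf 1\{X_i>0\}$; the sample median $M_n$ (the mean of the two middle order statistics if $n$ is even); and the log-likelihood ratio $\log\Lambda_n=\sum_{i=1}^n|X_i|-\sum_{i=1}^n|X_i-\hat\theta_n|$ with $\hat\theta_n=\max\{0,M_n\}$. For a statistic $T_n$ and $\theta>0$, a sequence $t_n(\theta)$ of real numbers is called typical if $T_n/t_n(\theta)\to1$ $P_\theta$-almost surely. The number $c_T(\theta)$ is the (exact) Bahadur slope of $T$ at $\theta$ if typical sequences exist, if $$-\frac2n\log P_0\bigl(T_n\ge t_n(\theta)\bigr)\longrightarrow c_T(\theta)$$ for every typical sequence $t_n(\theta)$, and if the same limit holds $P_\theta$-almost surely when $t_n(\theta)$ is replaced by the observed value of $T_n$ (so that $P_0(T_n\ge\cdot)$ becomes the observed p-value). Then the Bahadur slopes of the three tests exist for every $\theta>0$,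 and: 1. (Sign test) With $p(\theta)=P_\theta(X_1>0)=1-\tfrac12e^{-\theta}$, the sequence $n\,p(\theta)$ is typical for $V_n$ and $c_{\mathrm{sign}}(\theta)=2\,\mathrm{KL}(\mathrm{Ber}(p(\theta))\,\|\,\mathrm{Ber}(1/2))<\infty$ for every $\theta>0$. 2. (Median test) The constant sequence $\theta$ is typical for $M_n$ for every $\theta>0$, and $c_{\mathrm{med}}(\theta)/\theta^2\to1$ as $\theta\downarrow0$. 3. (Likelihood ratio test) For every $\theta>0$ the sequence $n\,\mathrm{KL}(f_\theta\|f_0)$ is typical for $\log\Lambda_n$, and $c_{\mathrm{LRT}}(\theta)=2\,\mathrm{KL}(f_\theta\,\|\,f_0)=2(e^{-\theta}+\theta-1)$. -/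

import Mathlib

open MeasureTheory ProbabilityTheory Filter Asymptotics
open scoped Topology ENNReal

namespace LaplaceLocation

/-- The Laplace density `f(x | θ) = (1/2) exp(-|x - θ|)`. -/
noncomputable def density (θ x : ℝ) : ℝ :=
  (1 / 2) * Real.exp (-|x - θ|)

/-- The Laplace distribution with location `θ` and unit scale. -/
noncomputable def law (θ : ℝ) : Measure ℝ :=
  volume.withDensity (fun x => ENNReal.ofReal (density θ x))

instance instIsProbabilityMeasureLaw (θ : ℝ) : IsProbabilityMeasure (law θ) := by
  have h1 : ∫ x : ℝ, Real.exp (-|x|) = 2 := by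
    rw [integral_comp_abs (f := fun x => Real.exp (-x)), integral_exp_neg_Ioi_zero]
    norm_num
  have h2 : Integrable (fun x : ℝ => Real.exp (-|x|)) := by
    by_contra h
    rw [integral_undef h] at h1
    norm_num at h1
  have h3 : Integrable (density θ) := (h2.comp_sub_right θ).const_mul (1 / 2)
  have h4 : ∫ x, density θ x = 1 := by
    unfold density
    rw [integral_const_mul, integral_sub_right_eq_self (fun x : ℝ => Real.exp (-|x|)), h1]
    norm_num
  refine ⟨?_⟩
  rw [law, withDensity_apply _ MeasurableSet.univ, Measure.restrict_univ,
    ← ofReal_integral_eq_lintegral_ofReal h3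
      (ae_of_all _ fun x => by unfold density; positivity), h4, ENNReal.ofReal_one]

/-- The joint law `P_θ` of an i.i.d. sequence with marginal `law θ`. -/
noncomputable def seqLaw (θ : ℝ) : Measure (ℕ → ℝ) :=
  Measure.infinitePi (fun _ : ℕ => law θ)

/-- The first `n` observations of a data sequence. -/
def firstObs (n : ℕ) (ω : ℕ → ℝ) : Fin n → ℝ := fun i => ω i

/-- `p(θ) = P_θ(X > 0)`, as a point of `[0, 1]`. -/
noncomputable def posProb (θ : ℝ) : unitInterval :=
  ⟨(law θ).real (Set.Ioi 0), measureReal_nonneg, measureReal_le_one⟩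

/-- The Bernoulli distribution on `{0, 1} ⊆ ℝ` with success probability `p`. -/
noncomputable def ber (p : unitInterval) : Measure ℝ := bernoulliMeasure 1 0 p

/-- The sign statistic `V_n`, the number of positive observations. -/
noncomputable def signStat (n : ℕ) (x : Fin n → ℝ) : ℝ :=
  ∑ i, Set.indicator (Set.Ioi (0 : ℝ)) (fun _ => (1 : ℝ)) (x i)

/-- The sample median `M_n`: the middle order statistic if `n` is odd, the mean of the two middle
order statistics if `n` is even and positive (and `0` for the empty sample). -/
noncomputable def sampleMedian (n : ℕ) (x : Fin n → ℝ) : ℝ :=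
  if h : 0 < n then
    (x (Tuple.sort x ⟨(n - 1) / 2, by omega⟩) + x (Tuple.sort x ⟨n / 2, by omega⟩)) / 2
  else 0

/-- The maximum likelihood estimator `max {0, median}` of `θ ≥ 0`. -/
noncomputable def mle (n : ℕ) (x : Fin n → ℝ) : ℝ := max 0 (sampleMedian n x)

/-- The likelihood ratio statistic `Λ_n`. -/
noncomputable def lrtStat (n : ℕ) (x : Fin n → ℝ) : ℝ :=
  Real.exp (-(∑ i, |x i - mle n x|) + ∑ i, |x i|)

/-- The logarithm of the likelihood ratio statistic. -/
noncomputable def logLrtStat (n : ℕ) (x : Fin n → ℝ) : ℝ := Real.log (lrtStat n x)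

/-- The null tail probability `P_0(T_n ≥ t)`. -/
noncomputable def nullTail (T : (n : ℕ) → (Fin n → ℝ) → ℝ) (n : ℕ) (t : ℝ) : ℝ :=
  (Measure.pi (fun _ : Fin n => law 0)).real {x | t ≤ T n x}

/-- `t n` is asymptotically the value which `T_n` takes under `θ`:
`T_n / t_n → 1` almost surely under `P_θ`. -/
def IsTypicalLevel (T : (n : ℕ) → (Fin n → ℝ) → ℝ) (θ : ℝ) (t : ℕ → ℝ) : Prop :=
  ∀ᵐ ω ∂(seqLaw θ), Tendsto (fun n => T n (firstObs n ω) / t n) atTop (𝓝 1)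

/-- `c` is the (exact) Bahadur slope at `θ` of the test of `θ = 0` which rejects for large values
of `T_n`: both along every typical level `t_n` of `T_n` under `θ`, and `P_θ`-almost surely along
the observed value of `T_n` (that is, for the observed p-value),
`-(2/n) log P_0(T_n ≥ ·)` converges to `c`. -/
structure IsBahadurSlope (T : (n : ℕ) → (Fin n → ℝ) → ℝ) (θ c : ℝ) : Prop where
  exists_typical : ∃ t : ℕ → ℝ, IsTypicalLevel T θ t
  tendsto_level : ∀ t : ℕ → ℝ, IsTypicalLevel T θ t →
    Tendsto (fun n : ℕ => -(2 / (n : ℝ)) * Real.log (nullTail T n (t n))) atTop (𝓝 c)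
  tendsto_pvalue : ∀ᵐ ω ∂(seqLaw θ),
    Tendsto (fun n : ℕ => -(2 / (n : ℝ)) * Real.log (nullTail T n (T n (firstObs n ω))))
      atTop (𝓝 c)

end LaplaceLocation

namespace LaplaceLocation

/-! ### Product measures and exponential tilting -/

/-! Bahadur's scheme: if `T_n / a_n → L` almost surely under the alternative, and the null tail at
`a_n * s` has exponential rate close to `c / 2` for suitable `s` just above and just below `L`, then
monotonicity of the tail in the level transfers the rate to every typical level and to the observed
value (`isBahadurSlope_of_tail_bounds`).

The tail bounds come from exponential tilting. Markov's inequality for a likelihood ratio bounds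
tails above (`pi_real_sum_ge_le_exp`); changing to a law under which the rare event is typical
bounds them below, at a cost of the Kullback-Leibler divergence per observation
(`eventually_exp_le_pi_real_sum_ge`).

For the sign test and the median the relevant events count observations in a half-line, so the rates
are Bernoulli divergences `binKL`. The median is at least `s` when more than half of the sample is,
and only when at least half is; its slope is therefore `θ - log (2 - exp (-θ))`, which is equivalent
to `θ ^ 2` at `0`.

For the likelihood ratio, the median minimizes absolute deviations, so the log statistic is the
supremum over `η ≥ 0` of `∑ logRatio η (x i)`. One `η` slightly above `θ` gives the lower bound. For
the upper bound, `logRatio` is 1-Lipschitz in `η`, so a finite grid on `[0, R]` and a union bound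
suffice, while an estimate of at least `R` is excluded by the median tail
(`nullTail_logLrtStat_le`). -/

theorem pi_eq_withDensity_prod {μ ν : Measure ℝ} [IsProbabilityMeasure μ] [IsProbabilityMeasure ν]
    {g : ℝ → ℝ≥0∞} (hg : Measurable g) (hν : ν = μ.withDensity g) (n : ℕ) :
    Measure.pi (fun _ : Fin n => ν) =
      (Measure.pi (fun _ : Fin n => μ)).withDensity (fun x => ∏ i, g (x i)) := by
  refine Measure.pi_eq fun s hs => ?_
  rw [withDensity_apply _ (MeasurableSet.univ_pi hs),
    ← lintegral_indicator (MeasurableSet.univ_pi hs)]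
  have h1 : (Set.univ.pi s).indicator (fun x : Fin n → ℝ => ∏ i, g (x i)) =
      fun x => ∏ i, (s i).indicator g (x i) := by
    funext x
    by_cases hx : x ∈ Set.univ.pi s
    · rw [Set.indicator_of_mem hx]
      exact Finset.prod_congr rfl fun i _ => (Set.indicator_of_mem (hx i trivial) _).symm
    · rw [Set.indicator_of_notMem hx]
      simp only [Set.mem_univ_pi, not_forall] at hx
      obtain ⟨i, hi⟩ := hx
      exact (Finset.prod_eq_zero (Finset.mem_univ i) (Set.indicator_of_notMem hi _)).symm
  have hm : ∀ i, Measurable ((s i).indicator g) := fun i => hg.indicator (hs i)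
  have hind : iIndepFun (fun i (x : Fin n → ℝ) => (s i).indicator g (x i))
      (Measure.pi (fun _ : Fin n => μ)) :=
    iIndepFun_pi (X := fun i => (s i).indicator g) (fun i => (hm i).aemeasurable)
  rw [h1]
  have h2 := lintegral_prod_eq_prod_lintegral_of_indepFun Finset.univ
    (fun i (x : Fin n → ℝ) => (s i).indicator g (x i)) hind
    (fun i => (hm i).comp (measurable_pi_apply i))
  rw [h2]
  refine Finset.prod_congr rfl fun i _ => ?_
  rw [hν, withDensity_apply _ (hs i), ← lintegral_indicator (hs i)]
  exact (measurePreserving_eval (fun _ : Fin n => μ) i).lintegral_comp (hm i)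

theorem pi_apply_eq_lintegral_exp {μ ν : Measure ℝ} [IsProbabilityMeasure μ]
    [IsProbabilityMeasure ν] {ℓ : ℝ → ℝ} (hℓ : Measurable ℓ)
    (hν : ν = μ.withDensity fun x => ENNReal.ofReal (Real.exp (ℓ x))) (n : ℕ)
    {A : Set (Fin n → ℝ)} (hA : MeasurableSet A) :
    Measure.pi (fun _ : Fin n => ν) A =
      ∫⁻ x in A, ENNReal.ofReal (Real.exp (∑ i, ℓ (x i))) ∂Measure.pi (fun _ : Fin n => μ) := by
  rw [pi_eq_withDensity_prod (by fun_prop) hν, withDensity_apply _ hA]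
  refine lintegral_congr fun x => ?_
  rw [Real.exp_sum, ENNReal.ofReal_prod_of_nonneg fun i _ => (Real.exp_pos _).le]

/-- Markov's inequality for a likelihood ratio. -/
theorem pi_real_sum_ge_le_exp {μ ν : Measure ℝ} [IsProbabilityMeasure μ]
    [IsProbabilityMeasure ν] {ℓ : ℝ → ℝ} (hℓ : Measurable ℓ)
    (hν : ν = μ.withDensity fun x => ENNReal.ofReal (Real.exp (ℓ x))) (n : ℕ) (b : ℝ) :
    (Measure.pi (fun _ : Fin n => μ)).real {x | b ≤ ∑ i, ℓ (x i)} ≤ Real.exp (-b) := by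
  have hA : MeasurableSet {x : Fin n → ℝ | b ≤ ∑ i, ℓ (x i)} :=
    measurableSet_le measurable_const (by fun_prop)
  have h1 : ENNReal.ofReal (Real.exp b) *
      Measure.pi (fun _ : Fin n => μ) {x | b ≤ ∑ i, ℓ (x i)} ≤ 1 := by
    calc _ = ∫⁻ _ in {x : Fin n → ℝ | b ≤ ∑ i, ℓ (x i)}, ENNReal.ofReal (Real.exp b)
          ∂Measure.pi (fun _ : Fin n => μ) := by rw [setLIntegral_const]
      _ ≤ ∫⁻ x in {x : Fin n → ℝ | b ≤ ∑ i, ℓ (x i)}, ENNReal.ofReal (Real.exp (∑ i, ℓ (x i)))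
          ∂Measure.pi (fun _ : Fin n => μ) :=
        setLIntegral_mono' hA fun x hx => ENNReal.ofReal_le_ofReal (Real.exp_le_exp.2 hx)
      _ = Measure.pi (fun _ : Fin n => ν) {x | b ≤ ∑ i, ℓ (x i)} :=
        (pi_apply_eq_lintegral_exp hℓ hν n hA).symm
      _ ≤ 1 := prob_le_one
  have h2 := ENNReal.toReal_mono ENNReal.one_ne_top h1
  rw [ENNReal.toReal_mul, ENNReal.toReal_ofReal (Real.exp_pos _).le, ENNReal.toReal_one] at h2
  rw [Real.exp_neg, ← one_div, le_div_iff₀ (Real.exp_pos _), mul_comm]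
  exact h2

/-- Counterpart of Markov's bound: the density of the tilted product law is at most `exp b` on `A`,
so undoing the tilt loses at most that factor. -/
theorem exp_neg_mul_pi_real_le {μ ν : Measure ℝ} [IsProbabilityMeasure μ]
    [IsProbabilityMeasure ν] {ℓ : ℝ → ℝ} (hℓ : Measurable ℓ)
    (hν : ν = μ.withDensity fun x => ENNReal.ofReal (Real.exp (ℓ x))) (n : ℕ) (b : ℝ)
    {A : Set (Fin n → ℝ)} (hA : MeasurableSet A) (hb : ∀ x ∈ A, ∑ i, ℓ (x i) ≤ b) :
    Real.exp (-b) * (Measure.pi (fun _ : Fin n => ν)).real A ≤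
      (Measure.pi (fun _ : Fin n => μ)).real A := by
  have h1 : Measure.pi (fun _ : Fin n => ν) A ≤
      ENNReal.ofReal (Real.exp b) * Measure.pi (fun _ : Fin n => μ) A := by
    calc _ = ∫⁻ x in A, ENNReal.ofReal (Real.exp (∑ i, ℓ (x i)))
          ∂Measure.pi (fun _ : Fin n => μ) := pi_apply_eq_lintegral_exp hℓ hν n hA
      _ ≤ ∫⁻ _ in A, ENNReal.ofReal (Real.exp b) ∂Measure.pi (fun _ : Fin n => μ) :=
        setLIntegral_mono' hA fun x hx => ENNReal.ofReal_le_ofReal (Real.exp_le_exp.2 (hb x hx))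
      _ = _ := by rw [setLIntegral_const]
  have h2 := ENNReal.toReal_mono (by finiteness) h1
  rw [ENNReal.toReal_mul, ENNReal.toReal_ofReal (Real.exp_pos _).le] at h2
  rw [Real.exp_neg, inv_mul_le_iff₀ (Real.exp_pos _)]
  exact h2

theorem map_firstObs (ν : Measure ℝ) [IsProbabilityMeasure ν] (n : ℕ) :
    (Measure.infinitePi (fun _ : ℕ => ν)).map (firstObs n) = Measure.pi (fun _ : Fin n => ν) := by
  rw [← Measure.infinitePi_eq_pi]
  exact Measure.map_infinitePi_infinitePi_of_inj (P := fun _ : ℕ => ν)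
    (f := fun i : Fin n => (i : ℕ)) Fin.val_injective

theorem measurable_firstObs (n : ℕ) : Measurable (firstObs n) := by
  unfold firstObs; fun_prop

/-- The strong law of large numbers for the coordinates of an i.i.d. sequence. -/
theorem ae_tendsto_mean {ν : Measure ℝ} [IsProbabilityMeasure ν] {h : ℝ → ℝ} (hm : Measurable h)
    (hi : Integrable h ν) :
    ∀ᵐ ω ∂Measure.infinitePi (fun _ : ℕ => ν),
      Tendsto (fun n : ℕ => (∑ i, h (firstObs n ω i)) / n) atTop (𝓝 (∫ x, h x ∂ν)) := by
  have hmp := fun i : ℕ => measurePreserving_eval_infinitePi (fun _ : ℕ => ν) i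
  have hind := iIndepFun_infinitePi (P := fun _ : ℕ => ν) (X := fun _ : ℕ => h) (fun _ => hm)
  have key := strong_law_ae_real (μ := Measure.infinitePi (fun _ : ℕ => ν))
    (fun i ω => h (ω i)) ((hmp 0).integrable_comp_of_integrable hi)
    (fun i j hij => hind.indepFun hij)
    (fun i => ⟨(hm.comp (measurable_pi_apply i)).aemeasurable,
      (hm.comp (measurable_pi_apply 0)).aemeasurable, by
        have e : ∀ i : ℕ, (Measure.infinitePi (fun _ : ℕ => ν)).map (fun ω => h (ω i)) =
            ν.map h := fun i => by
          conv_rhs => rw [← (hmp i).map_eq, Measure.map_map hm (hmp i).measurable]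
          rfl
        rw [e i, e 0]⟩)
  have hint : ∫ ω, h (ω 0) ∂Measure.infinitePi (fun _ : ℕ => ν) = ∫ x, h x ∂ν := by
    conv_rhs => rw [← (hmp 0).map_eq]
    rw [integral_map (hmp 0).measurable.aemeasurable hm.aestronglyMeasurable]
  rw [hint] at key
  filter_upwards [key] with ω hω
  refine hω.congr fun n => ?_
  rw [Finset.sum_range]
  rfl

/-- An event which almost surely holds eventually has probability at least `1/2` eventually. -/
theorem eventually_half_le_pi_real {ν : Measure ℝ} [IsProbabilityMeasure ν]
    {A : (n : ℕ) → Set (Fin n → ℝ)} (hA : ∀ n, MeasurableSet (A n))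
    (h : ∀ᵐ ω ∂Measure.infinitePi (fun _ : ℕ => ν), ∀ᶠ n in atTop, firstObs n ω ∈ A n) :
    ∀ᶠ n in atTop, 1 / 2 ≤ (Measure.pi (fun _ : Fin n => ν)).real (A n) := by
  set P := Measure.infinitePi (fun _ : ℕ => ν)
  have hmA : ∀ n, MeasurableSet (firstObs n ⁻¹' A n) := fun n => measurable_firstObs n (hA n)
  have h1 : Tendsto (fun n => ∫ ω, (firstObs n ⁻¹' A n).indicator (fun _ => (1 : ℝ)) ω ∂P) atTop
      (𝓝 (∫ _, (1 : ℝ) ∂P)) := by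
    refine tendsto_integral_of_dominated_convergence (fun _ => (1 : ℝ))
      (fun n => (measurable_const.indicator (hmA n)).aestronglyMeasurable)
      (integrable_const _) (fun n => ae_of_all _ fun ω => ?_) ?_
    · by_cases hω : ω ∈ firstObs n ⁻¹' A n <;> simp [hω]
    · filter_upwards [h] with ω hω
      refine tendsto_const_nhds.congr' ?_
      filter_upwards [hω] with n hn
      rw [Set.indicator_of_mem (show ω ∈ firstObs n ⁻¹' A n from hn)]
  have h2 : ∀ n, ∫ ω, (firstObs n ⁻¹' A n).indicator (fun _ => (1 : ℝ)) ω ∂P =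
      (Measure.pi (fun _ : Fin n => ν)).real (A n) := fun n => by
    rw [integral_indicator (hmA n), ← map_firstObs ν n,
      map_measureReal_apply (measurable_firstObs n) (hA n)]
    simp [P]
  simp only [h2, integral_const, probReal_univ, smul_eq_mul, mul_one] at h1
  exact h1.eventually (eventually_ge_nhds (by norm_num))

/-- The change-of-measure lower bound for the probability of a large deviation. -/
theorem eventually_exp_le_pi_real_sum_ge {μ ν : Measure ℝ} [IsProbabilityMeasure μ]
    [IsProbabilityMeasure ν] {ℓ h : ℝ → ℝ} (hℓ : Measurable ℓ)
    (hν : ν = μ.withDensity fun x => ENNReal.ofReal (Real.exp (ℓ x))) (hℓi : Integrable ℓ ν)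
    (hm : Measurable h) (hi : Integrable h ν) {s : ℝ} (hs : s < ∫ x, h x ∂ν) {ε : ℝ}
    (hε : 0 < ε) :
    ∀ᶠ n : ℕ in atTop, Real.exp (-(n * (∫ x, ℓ x ∂ν + ε))) ≤
      (Measure.pi (fun _ : Fin n => μ)).real {x | n * s ≤ ∑ i, h (x i)} := by
  set κ := ∫ x, ℓ x ∂ν
  -- Restricting to samples whose log-density is near its `ν`-mean keeps the density under control;
  -- by the strong law this event is typical under `ν`.
  let A : (n : ℕ) → Set (Fin n → ℝ) := fun n =>
    {x | n * s ≤ ∑ i, h (x i)} ∩ {x | ∑ i, ℓ (x i) ≤ n * (κ + ε / 2)}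
  have hA : ∀ n, MeasurableSet (A n) := fun n =>
    (measurableSet_le measurable_const (by fun_prop)).inter
      (measurableSet_le (by fun_prop) measurable_const)
  have hlln : ∀ᵐ ω ∂Measure.infinitePi (fun _ : ℕ => ν), ∀ᶠ n in atTop, firstObs n ω ∈ A n := by
    filter_upwards [ae_tendsto_mean hm hi, ae_tendsto_mean hℓ hℓi] with ω h1 h2
    filter_upwards [h1.eventually (eventually_ge_nhds hs),
      h2.eventually (eventually_le_nhds (show κ < κ + ε / 2 by linarith)),
      eventually_gt_atTop 0] with n hn1 hn2 hn0
    have hn0' : (0 : ℝ) < n := Nat.cast_pos.2 hn0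
    rw [le_div_iff₀ hn0'] at hn1
    rw [div_le_iff₀ hn0'] at hn2
    exact ⟨by simpa [mul_comm] using hn1, by simpa [mul_comm] using hn2⟩
  -- The other half of `ε` pays for the probability `1 / 2` of the typical event.
  have hbig : ∀ᶠ n : ℕ in atTop, Real.log 2 ≤ n * (ε / 2) :=
    (tendsto_natCast_atTop_atTop.atTop_mul_const (by positivity)).eventually_ge_atTop _
  filter_upwards [eventually_half_le_pi_real hA hlln, hbig] with n hn hn2
  have h3 := exp_neg_mul_pi_real_le hℓ hν n (n * (κ + ε / 2)) (hA n) (fun x hx => hx.2)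
  calc Real.exp (-(n * (κ + ε)))
      ≤ Real.exp (-(n * (κ + ε / 2)) + -Real.log 2) := Real.exp_le_exp.2 (by linarith)
    _ = Real.exp (-(n * (κ + ε / 2))) * (1 / 2) := by
      rw [Real.exp_add, Real.exp_neg (Real.log 2), Real.exp_log two_pos, one_div]
    _ ≤ Real.exp (-(n * (κ + ε / 2))) * (Measure.pi (fun _ : Fin n => ν)).real (A n) := by gcongr
    _ ≤ _ := h3
    _ ≤ _ := measureReal_mono Set.inter_subset_left

theorem llr_ae_eq {μ ν : Measure ℝ} [IsProbabilityMeasure μ] {ℓ : ℝ → ℝ} (hℓ : Measurable ℓ)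
    (hν : ν = μ.withDensity fun x => ENNReal.ofReal (Real.exp (ℓ x))) : llr ν μ =ᵐ[ν] ℓ := by
  have hac : ν ≪ μ := hν ▸ withDensity_absolutelyContinuous _ _
  refine hac.ae_le ?_
  have h1 := Measure.rnDeriv_withDensity μ
    (f := fun x => ENNReal.ofReal (Real.exp (ℓ x))) (by fun_prop)
  rw [← hν] at h1
  filter_upwards [h1] with x hx
  rw [llr, hx, ENNReal.toReal_ofReal (Real.exp_pos _).le, Real.log_exp]

theorem toReal_klDiv_eq_integral {μ ν : Measure ℝ} [IsProbabilityMeasure μ]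
    [IsProbabilityMeasure ν] {ℓ : ℝ → ℝ} (hℓ : Measurable ℓ)
    (hν : ν = μ.withDensity fun x => ENNReal.ofReal (Real.exp (ℓ x))) :
    (InformationTheory.klDiv ν μ).toReal = ∫ x, ℓ x ∂ν := by
  rw [InformationTheory.toReal_klDiv_of_measure_eq
    (hν ▸ withDensity_absolutelyContinuous _ _) (by simp), integral_congr_ae (llr_ae_eq hℓ hν)]

theorem klDiv_ne_top_of_integrable {μ ν : Measure ℝ} [IsProbabilityMeasure μ]
    {ℓ : ℝ → ℝ} (hℓ : Measurable ℓ)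
    (hν : ν = μ.withDensity fun x => ENNReal.ofReal (Real.exp (ℓ x))) (hℓi : Integrable ℓ ν) :
    InformationTheory.klDiv ν μ ≠ ∞ :=
  InformationTheory.klDiv_ne_top (hν ▸ withDensity_absolutelyContinuous _ _)
    (hℓi.congr (llr_ae_eq hℓ hν).symm)

/-! ### A criterion for the existence of the Bahadur slope -/

theorem nullTail_antitone (T : (n : ℕ) → (Fin n → ℝ) → ℝ) (n : ℕ) : Antitone (nullTail T n) :=
  fun _ _ h => measureReal_mono fun _ hx => h.trans hx

/-- Eventually `t n` lies between `a n` times a number below `L` and `a n` times one above it, so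
the antitone tail is squeezed. No continuity in `s` is assumed beyond one good `s` on each side for
every `ε`. -/
theorem tendsto_log_nullTail {T : (n : ℕ) → (Fin n → ℝ) → ℝ} {a t : ℕ → ℝ} {L c : ℝ}
    (ha : ∀ᶠ n in atTop, 0 < a n)
    (hlow : ∀ ε > 0, ∃ s > L, ∀ᶠ n : ℕ in atTop,
      Real.exp (-(n * (c / 2 + ε))) ≤ nullTail T n (a n * s))
    (hup : ∀ ε > 0, ∃ s < L, ∀ᶠ n : ℕ in atTop,
      nullTail T n (a n * s) ≤ Real.exp (-(n * (c / 2 - ε))))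
    (ht : Tendsto (fun n => t n / a n) atTop (𝓝 L)) :
    Tendsto (fun n : ℕ => -(2 / (n : ℝ)) * Real.log (nullTail T n (t n))) atTop (𝓝 c) := by
  have hlow' : ∀ ε > 0, ∀ᶠ n : ℕ in atTop,
      Real.exp (-(n * (c / 2 + ε))) ≤ nullTail T n (t n) := fun ε hε => by
    obtain ⟨s, hs, h⟩ := hlow ε hε
    filter_upwards [h, ha, ht.eventually (eventually_le_nhds hs)] with n h1 h2 h3
    rw [div_le_iff₀ h2] at h3
    exact h1.trans (nullTail_antitone T n (by linarith))
  have hup' : ∀ ε > 0, ∀ᶠ n : ℕ in atTop,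
      nullTail T n (t n) ≤ Real.exp (-(n * (c / 2 - ε))) := fun ε hε => by
    obtain ⟨s, hs, h⟩ := hup ε hε
    filter_upwards [h, ha, ht.eventually (eventually_ge_nhds hs)] with n h1 h2 h3
    rw [le_div_iff₀ h2] at h3
    exact (nullTail_antitone T n (by linarith)).trans h1
  rw [Metric.tendsto_nhds]
  intro δ hδ
  filter_upwards [hlow' (δ / 4) (by positivity), hup' (δ / 4) (by positivity),
    eventually_gt_atTop 0] with n h1 h2 hn
  have hn' : (0 : ℝ) < n := Nat.cast_pos.2 hn
  have hpos : 0 < nullTail T n (t n) := (Real.exp_pos _).trans_le h1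
  rw [← Real.le_log_iff_exp_le hpos] at h1
  rw [← Real.log_le_iff_le_exp hpos] at h2
  have e : -(2 / (n : ℝ)) * Real.log (nullTail T n (t n)) =
      2 * (-Real.log (nullTail T n (t n)) / n) := by ring
  have h3 : -Real.log (nullTail T n (t n)) / n ≤ c / 2 + δ / 4 := by
    rw [div_le_iff₀ hn']; linarith
  have h4 : c / 2 - δ / 4 ≤ -Real.log (nullTail T n (t n)) / n := by
    rw [le_div_iff₀ hn']; linarith
  rw [Real.dist_eq, e, abs_lt]
  constructor <;> linarith

theorem isTypicalLevel_of_ae_tendsto {T : (n : ℕ) → (Fin n → ℝ) → ℝ} {θ L : ℝ} {a : ℕ → ℝ}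
    (hL : L ≠ 0)
    (hlln : ∀ᵐ ω ∂seqLaw θ, Tendsto (fun n => T n (firstObs n ω) / a n) atTop (𝓝 L)) :
    IsTypicalLevel T θ (fun n => a n * L) := by
  filter_upwards [hlln] with ω hω
  have := hω.div_const L
  rw [div_self hL] at this
  exact this.congr fun n => by rw [div_div]

/-- The Bahadur slope is determined by a law of large numbers under the alternative and by
exponential tail bounds under the null hypothesis near the limit value. -/
theorem isBahadurSlope_of_tail_bounds {T : (n : ℕ) → (Fin n → ℝ) → ℝ} {θ L c : ℝ} {a : ℕ → ℝ}
    (hL : L ≠ 0) (ha : ∀ᶠ n in atTop, 0 < a n)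
    (hlln : ∀ᵐ ω ∂seqLaw θ, Tendsto (fun n => T n (firstObs n ω) / a n) atTop (𝓝 L))
    (hlow : ∀ ε > 0, ∃ s > L, ∀ᶠ n : ℕ in atTop,
      Real.exp (-(n * (c / 2 + ε))) ≤ nullTail T n (a n * s))
    (hup : ∀ ε > 0, ∃ s < L, ∀ᶠ n : ℕ in atTop,
      nullTail T n (a n * s) ≤ Real.exp (-(n * (c / 2 - ε)))) :
    IsBahadurSlope T θ c where
  exists_typical := ⟨_, isTypicalLevel_of_ae_tendsto hL hlln⟩
  tendsto_level t ht := by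
    refine tendsto_log_nullTail ha hlow hup ?_
    have : IsProbabilityMeasure (seqLaw θ) := by unfold seqLaw; infer_instance
    -- One sample path on which both limits hold is enough to compare the deterministic sequences
    -- `t` and `a`.
    obtain ⟨ω, h1, h2⟩ := (hlln.and ht).exists
    have h3 := h1.div h2 one_ne_zero
    rw [div_one] at h3
    refine h3.congr' ?_
    filter_upwards [h2.eventually_ne one_ne_zero] with n hn
    obtain ⟨hT, ht0⟩ := div_ne_zero_iff.1 hn
    rw [Pi.div_apply]
    field_simp
  tendsto_pvalue := by
    filter_upwards [hlln] with ω hω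
    exact tendsto_log_nullTail ha hlow hup hω

end LaplaceLocation

namespace LaplaceLocation

/-! ### Large deviations of the number of observations in a set -/

/-- The Kullback-Leibler divergence between the Bernoulli laws of parameters `p` and `q`. -/
noncomputable def binKL (p q : ℝ) : ℝ :=
  p * Real.log (p / q) + (1 - p) * Real.log ((1 - p) / (1 - q))

open Classical in
/-- The log-density of the tilt which changes the probability of `S` from `q` to `p`. -/
noncomputable def binLogRatio (S : Set ℝ) (p q : ℝ) (x : ℝ) : ℝ :=
  if x ∈ S then Real.log (p / q) else Real.log ((1 - p) / (1 - q))

/-- The number of observations in `S`. -/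
noncomputable def countIn (S : Set ℝ) {n : ℕ} (x : Fin n → ℝ) : ℝ :=
  ∑ i, S.indicator (fun _ => (1 : ℝ)) (x i)

variable {S : Set ℝ} {p q : ℝ}

theorem measurable_binLogRatio (hS : MeasurableSet S) : Measurable (binLogRatio S p q) :=
  Measurable.ite hS measurable_const measurable_const

theorem binLogRatio_eq (x : ℝ) : binLogRatio S p q x =
    S.indicator (fun _ => (1 : ℝ)) x * (Real.log (p / q) - Real.log ((1 - p) / (1 - q))) +
      Real.log ((1 - p) / (1 - q)) := by
  by_cases hx : x ∈ S <;> simp [binLogRatio, hx]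

theorem withDensity_binLogRatio_apply (hS : MeasurableSet S) (hp : p ∈ Set.Ioo 0 1)
    (hq : q ∈ Set.Ioo 0 1) (μ : Measure ℝ) {A : Set ℝ} (hA : MeasurableSet A) :
    μ.withDensity (fun x => ENNReal.ofReal (Real.exp (binLogRatio S p q x))) A =
      ENNReal.ofReal (p / q) * μ (A ∩ S) + ENNReal.ofReal ((1 - p) / (1 - q)) * μ (A ∩ Sᶜ) := by
  have h1 : 0 < p / q := div_pos hp.1 hq.1
  have h2 : 0 < (1 - p) / (1 - q) := div_pos (sub_pos.2 hp.2) (sub_pos.2 hq.2)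
  rw [withDensity_apply _ hA, ← lintegral_inter_add_sdiff _ A hS,
    setLIntegral_congr_fun (hA.inter hS) (g := fun _ => ENNReal.ofReal (p / q))
      (fun x hx => by simp [binLogRatio, hx.2, Real.exp_log h1]),
    setLIntegral_congr_fun (hA.diff hS) (g := fun _ => ENNReal.ofReal ((1 - p) / (1 - q)))
      (fun x hx => by
        have : x ∉ S := hx.2
        simp [binLogRatio, this, Real.exp_log h2]),
    setLIntegral_const, setLIntegral_const, Set.sdiff_eq]

/-- Reweighting by `p / q` on `S` and by `(1 - p) / (1 - q)` off `S` turns the masses `q`, `1 - q`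
into `p`, `1 - p`. -/
theorem exists_tilt (hS : MeasurableSet S) (hp : p ∈ Set.Ioo 0 1) (hq : q ∈ Set.Ioo 0 1)
    (μ : Measure ℝ) [IsProbabilityMeasure μ] (hμ : μ.real S = q) :
    ∃ ν : Measure ℝ, IsProbabilityMeasure ν ∧
      ν = μ.withDensity (fun x => ENNReal.ofReal (Real.exp (binLogRatio S p q x))) ∧
      ν.real S = p := by
  have hq1 : μ S = ENNReal.ofReal q := by rw [← hμ, ofReal_measureReal]
  have hq2 : μ Sᶜ = ENNReal.ofReal (1 - q) := by
    rw [← hμ, ← probReal_compl_eq_one_sub hS, ofReal_measureReal]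
  have h1 : 0 ≤ p / q := (div_pos hp.1 hq.1).le
  have h2 : 0 ≤ (1 - p) / (1 - q) := (div_pos (sub_pos.2 hp.2) (sub_pos.2 hq.2)).le
  have hq0 : q ≠ 0 := hq.1.ne'
  have hq3 : 1 - q ≠ 0 := (sub_pos.2 hq.2).ne'
  refine ⟨_, ⟨?_⟩, rfl, ?_⟩
  · rw [withDensity_binLogRatio_apply hS hp hq μ MeasurableSet.univ, Set.univ_inter,
      Set.univ_inter, hq1, hq2, ← ENNReal.ofReal_mul h1, ← ENNReal.ofReal_mul h2,
      div_mul_cancel₀ _ hq0, div_mul_cancel₀ _ hq3,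
      ← ENNReal.ofReal_add hp.1.le (sub_pos.2 hp.2).le]
    simp
  · rw [measureReal_def, withDensity_binLogRatio_apply hS hp hq μ hS, Set.inter_self,
      Set.inter_compl_self, measure_empty, mul_zero, add_zero, hq1, ← ENNReal.ofReal_mul h1,
      div_mul_cancel₀ _ hq0, ENNReal.toReal_ofReal hp.1.le]

theorem integrable_indicator_one (hS : MeasurableSet S) (ν : Measure ℝ) [IsFiniteMeasure ν] :
    Integrable (S.indicator fun _ => (1 : ℝ)) ν :=
  (integrable_const 1).indicator hS

theorem integral_indicator_one_real (hS : MeasurableSet S) (ν : Measure ℝ) :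
    ∫ x, S.indicator (fun _ => (1 : ℝ)) x ∂ν = ν.real S := by
  rw [integral_indicator hS]
  simp

theorem integrable_binLogRatio (hS : MeasurableSet S) (ν : Measure ℝ) [IsFiniteMeasure ν] :
    Integrable (binLogRatio S p q) ν := by
  rw [funext (binLogRatio_eq (S := S) (p := p) (q := q))]
  exact ((integrable_indicator_one hS ν).mul_const _).add (integrable_const _)

theorem integral_binLogRatio (hS : MeasurableSet S) (ν : Measure ℝ) [IsProbabilityMeasure ν]
    (hν : ν.real S = p) : ∫ x, binLogRatio S p q x ∂ν = binKL p q := by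
  simp_rw [binLogRatio_eq]
  rw [integral_add ((integrable_indicator_one hS ν).mul_const _) (integrable_const _),
    integral_mul_const, integral_indicator_one_real hS, hν, binKL]
  simp
  ring

/-- Chernoff's bound for the number of observations in `S`. -/
theorem pi_real_countIn_ge_le (hS : MeasurableSet S) (hp : p ∈ Set.Ioo 0 1)
    (hq : q ∈ Set.Ioo 0 1) (hqp : q ≤ p) (μ : Measure ℝ) [IsProbabilityMeasure μ]
    (hμ : μ.real S = q) (n : ℕ) :
    (Measure.pi (fun _ : Fin n => μ)).real {x | n * p ≤ countIn S x} ≤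
      Real.exp (-(n * binKL p q)) := by
  obtain ⟨ν, _, hν, -⟩ := exists_tilt hS hp hq μ hμ
  refine le_trans (measureReal_mono fun x hx => ?_)
    (pi_real_sum_ge_le_exp (measurable_binLogRatio hS) hν n (n * binKL p q))
  have hx' : (n : ℝ) * p ≤ countIn S x := hx
  -- The log-likelihood is affine in the count, with this slope; its sign turns a large count into a
  -- large likelihood ratio.
  have hd : 0 ≤ Real.log (p / q) - Real.log ((1 - p) / (1 - q)) := by
    have h1 : 0 ≤ Real.log (p / q) := Real.log_nonneg ((one_le_div hq.1).2 hqp)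
    have h2 : Real.log ((1 - p) / (1 - q)) ≤ 0 :=
      Real.log_nonpos (div_nonneg (sub_pos.2 hp.2).le (sub_pos.2 hq.2).le)
        ((div_le_one (sub_pos.2 hq.2)).2 (by linarith))
    linarith
  have h3 : ∑ i, binLogRatio S p q (x i) =
      countIn S x * (Real.log (p / q) - Real.log ((1 - p) / (1 - q))) +
        n * Real.log ((1 - p) / (1 - q)) := by
    simp_rw [binLogRatio_eq]
    rw [Finset.sum_add_distrib, ← Finset.sum_mul, countIn]
    simp
  have h4 := mul_le_mul_of_nonneg_right hx' hd
  rw [Set.mem_ofPred_eq, h3, binKL]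
  linarith

theorem eventually_exp_le_pi_real_countIn_ge (hS : MeasurableSet S) (hp : p ∈ Set.Ioo 0 1)
    (hq : q ∈ Set.Ioo 0 1) (μ : Measure ℝ) [IsProbabilityMeasure μ]
    (hμ : μ.real S = q) {s ε : ℝ} (hs : s < p) (hε : 0 < ε) :
    ∀ᶠ n : ℕ in atTop, Real.exp (-(n * (binKL p q + ε))) ≤
      (Measure.pi (fun _ : Fin n => μ)).real {x | n * s ≤ countIn S x} := by
  obtain ⟨ν, _, hν, hνp⟩ := exists_tilt hS hp hq μ hμ
  have := eventually_exp_le_pi_real_sum_ge (measurable_binLogRatio hS) hν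
    (integrable_binLogRatio hS ν) (measurable_const.indicator hS)
    (integrable_indicator_one hS ν)
    (by rw [integral_indicator_one_real hS, hνp]; exact hs) hε
  rwa [integral_binLogRatio hS ν hνp] at this

theorem continuousAt_binKL {x : ℝ × ℝ} (h1 : x.1 ∈ Set.Ioo 0 1) (h2 : x.2 ∈ Set.Ioo 0 1) :
    ContinuousAt (fun y : ℝ × ℝ => binKL y.1 y.2) x := by
  have a1 := h1.1.ne'
  have a2 := h2.1.ne'
  have a3 := (sub_pos.2 h1.2).ne'
  have a4 := (sub_pos.2 h2.2).ne'
  unfold binKL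
  refine ContinuousAt.add (ContinuousAt.mul (by fun_prop) (ContinuousAt.log ?_ ?_))
    (ContinuousAt.mul (by fun_prop) (ContinuousAt.log ?_ ?_))
  · exact ContinuousAt.div (by fun_prop) (by fun_prop) a2
  · exact div_ne_zero a1 a2
  · exact ContinuousAt.div (by fun_prop) (by fun_prop) a4
  · exact div_ne_zero a3 a4

theorem ber_apply (p : unitInterval) {A : Set ℝ} (hA : MeasurableSet A) :
    ber p A = ENNReal.ofReal p * A.indicator 1 1 + ENNReal.ofReal (1 - p) * A.indicator 1 0 := by
  have h1 : ENNReal.ofReal (p : ℝ) = (unitInterval.toNNReal p : ℝ≥0∞) := by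
    rw [← ENNReal.ofReal_coe_nnreal]; rfl
  have h2 : ENNReal.ofReal (1 - (p : ℝ)) =
      (unitInterval.toNNReal (unitInterval.symm p) : ℝ≥0∞) := by
    rw [← ENNReal.ofReal_coe_nnreal]; rfl
  rw [h1, h2, ber, bernoulliMeasure_def, Measure.add_apply, Measure.smul_apply,
    Measure.smul_apply, Measure.dirac_apply' _ hA, Measure.dirac_apply' _ hA]
  rfl

instance instIsProbabilityMeasureBer (p : unitInterval) : IsProbabilityMeasure (ber p) := by
  unfold ber; infer_instance

theorem ber_real_Ioi (p : unitInterval) : (ber p).real (Set.Ioi 0) = p := by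
  rw [measureReal_def, ber_apply p measurableSet_Ioi]
  simp [p.2.1]

/-- The half-line `Set.Ioi 0` separates the atoms `1` and `0`, so the tilt used for counts also
serves here and identifies `binKL` with the measure-theoretic divergence. -/
theorem ber_eq_withDensity {p q : unitInterval} (hp : (p : ℝ) ∈ Set.Ioo (0 : ℝ) 1)
    (hq : (q : ℝ) ∈ Set.Ioo (0 : ℝ) 1) :
    ber p = (ber q).withDensity
      (fun x => ENNReal.ofReal (Real.exp (binLogRatio (Set.Ioi 0) p q x))) := by
  have hS : MeasurableSet (Set.Ioi (0 : ℝ)) := measurableSet_Ioi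
  ext A hA
  have h1 : 0 ≤ (p : ℝ) / q := (div_pos hp.1 hq.1).le
  have h2 : 0 ≤ (1 - (p : ℝ)) / (1 - q) := (div_pos (sub_pos.2 hp.2) (sub_pos.2 hq.2)).le
  have hq0 : (q : ℝ) ≠ 0 := hq.1.ne'
  have hq3 : 1 - (q : ℝ) ≠ 0 := (sub_pos.2 hq.2).ne'
  rw [withDensity_binLogRatio_apply hS hp hq _ hA, ber_apply p hA,
    ber_apply q (hA.inter hS), ber_apply q (hA.inter hS.compl)]
  have e1 : (A ∩ Set.Ioi (0 : ℝ)).indicator (1 : ℝ → ℝ≥0∞) 0 = 0 := by simp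
  have e2 : (A ∩ (Set.Ioi (0 : ℝ))ᶜ).indicator (1 : ℝ → ℝ≥0∞) 1 = 0 := by simp
  have e3 : (A ∩ Set.Ioi (0 : ℝ)).indicator (1 : ℝ → ℝ≥0∞) 1 = A.indicator 1 1 := by
    by_cases h : (1 : ℝ) ∈ A <;> simp [h]
  have e4 : (A ∩ (Set.Ioi (0 : ℝ))ᶜ).indicator (1 : ℝ → ℝ≥0∞) 0 = A.indicator 1 0 := by
    by_cases h : (0 : ℝ) ∈ A <;> simp [h]
  rw [e1, e2, e3, e4, mul_zero, mul_zero, add_zero, zero_add, ← mul_assoc, ← mul_assoc,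
    ← ENNReal.ofReal_mul h1, ← ENNReal.ofReal_mul h2, div_mul_cancel₀ _ hq0,
    div_mul_cancel₀ _ hq3]

theorem klDiv_ber_ne_top {p q : unitInterval} (hp : (p : ℝ) ∈ Set.Ioo (0 : ℝ) 1)
    (hq : (q : ℝ) ∈ Set.Ioo (0 : ℝ) 1) : InformationTheory.klDiv (ber p) (ber q) ≠ ∞ :=
  klDiv_ne_top_of_integrable (measurable_binLogRatio measurableSet_Ioi)
    (ber_eq_withDensity hp hq) (integrable_binLogRatio measurableSet_Ioi _)

theorem toReal_klDiv_ber {p q : unitInterval} (hp : (p : ℝ) ∈ Set.Ioo (0 : ℝ) 1)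
    (hq : (q : ℝ) ∈ Set.Ioo (0 : ℝ) 1) :
    (InformationTheory.klDiv (ber p) (ber q)).toReal = binKL p q := by
  rw [toReal_klDiv_eq_integral (measurable_binLogRatio measurableSet_Ioi)
    (ber_eq_withDensity hp hq), integral_binLogRatio measurableSet_Ioi _ (ber_real_Ioi p)]

end LaplaceLocation

namespace LaplaceLocation

/-! ### The Laplace distribution -/

theorem density_pos (θ x : ℝ) : 0 < density θ x := by unfold density; positivity

theorem continuous_density (θ : ℝ) : Continuous (density θ) := by unfold density; fun_prop

theorem integral_law (θ : ℝ) (g : ℝ → ℝ) :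
    ∫ x, g x ∂law θ = ∫ x, density θ x * g x := by
  rw [law, integral_withDensity_eq_integral_toReal_smul
    (continuous_density θ).measurable.ennreal_ofReal (ae_of_all _ fun _ => ENNReal.ofReal_lt_top)]
  simp [ENNReal.toReal_ofReal (density_pos θ _).le]

theorem law_real_apply (θ : ℝ) {A : Set ℝ} (hA : MeasurableSet A) :
    (law θ).real A = ∫ x in A, density θ x := by
  rw [← integral_indicator_one_real hA, integral_law, ← integral_indicator hA]
  congr 1
  funext x
  by_cases hx : x ∈ A <;> simp [hx]

theorem law_real_Ioi {θ s : ℝ} (h : θ ≤ s) :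
    (law θ).real (Set.Ioi s) = Real.exp (-(s - θ)) / 2 := by
  rw [law_real_apply θ measurableSet_Ioi,
    setIntegral_congr_fun measurableSet_Ioi (g := fun x => Real.exp θ / 2 * Real.exp (-x))
      (fun x hx => ?_), integral_const_mul, integral_exp_neg_Ioi]
  · rw [neg_sub, sub_eq_add_neg, Real.exp_add]; ring
  · have : θ ≤ x := h.trans (le_of_lt hx)
    simp only [density]
    rw [abs_of_nonneg (by linarith), neg_sub, sub_eq_add_neg, Real.exp_add]; ring

theorem law_real_Iic {θ s : ℝ} (h : s ≤ θ) :
    (law θ).real (Set.Iic s) = Real.exp (-(θ - s)) / 2 := by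
  rw [law_real_apply θ measurableSet_Iic,
    setIntegral_congr_fun measurableSet_Iic (g := fun x => Real.exp (-θ) / 2 * Real.exp x)
      (fun x hx => ?_), integral_const_mul, integral_exp_Iic]
  · rw [neg_sub, sub_eq_add_neg, Real.exp_add]; ring
  · have : x ≤ θ := le_trans hx h
    simp only [density]
    rw [abs_of_nonpos (by linarith), neg_neg, sub_eq_add_neg, Real.exp_add]; ring

instance instNullSingletonClassLaw (θ : ℝ) : NullSingletonClass (law θ) where
  measure_singleton x := withDensity_absolutelyContinuous _ _ (measure_singleton x)

theorem law_real_Ici {θ s : ℝ} (h : θ ≤ s) :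
    (law θ).real (Set.Ici s) = Real.exp (-(s - θ)) / 2 := by
  rw [← law_real_Ioi h]
  exact measureReal_congr Ioi_ae_eq_Ici.symm

theorem law_real_Ioi_of_le {θ s : ℝ} (h : s ≤ θ) :
    (law θ).real (Set.Ioi s) = 1 - Real.exp (-(θ - s)) / 2 := by
  rw [← law_real_Iic h, ← probReal_compl_eq_one_sub measurableSet_Iic, Set.compl_Iic]

theorem law_real_Ici_of_le {θ s : ℝ} (h : s ≤ θ) :
    (law θ).real (Set.Ici s) = 1 - Real.exp (-(θ - s)) / 2 := by
  rw [← law_real_Ioi_of_le h]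
  exact measureReal_congr Ioi_ae_eq_Ici.symm

/-- The log-likelihood ratio of one observation. -/
noncomputable def logRatio (η x : ℝ) : ℝ := |x| - |x - η|

theorem continuous_logRatio (η : ℝ) : Continuous (logRatio η) := by unfold logRatio; fun_prop

theorem abs_logRatio_le (η x : ℝ) : |logRatio η x| ≤ |η| := by
  have := abs_abs_sub_abs_le_abs_sub x (x - η)
  rwa [sub_sub_cancel] at this

theorem law_eq_withDensity (η : ℝ) :
    law η = (law 0).withDensity fun x => ENNReal.ofReal (Real.exp (logRatio η x)) := by
  have hm : Measurable fun x => ENNReal.ofReal (Real.exp (logRatio η x)) :=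
    (Real.continuous_exp.comp (continuous_logRatio η)).measurable.ennreal_ofReal
  rw [law, law, ← withDensity_mul _ (continuous_density 0).measurable.ennreal_ofReal hm]
  congr 1
  funext x
  rw [Pi.mul_apply, ← ENNReal.ofReal_mul (density_pos 0 x).le]
  congr 1
  rw [density, density, logRatio, mul_assoc, ← Real.exp_add]
  congr 2
  rw [sub_zero]; ring

theorem integrable_logRatio (η : ℝ) (ν : Measure ℝ) [IsFiniteMeasure ν] :
    Integrable (logRatio η) ν :=
  Integrable.of_bound (continuous_logRatio η).aestronglyMeasurable |η|
    (ae_of_all _ fun x => abs_logRatio_le η x)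

theorem integral_logRatio_law {η : ℝ} (hη : 0 ≤ η) :
    ∫ x, logRatio η x ∂law η = Real.exp (-η) + η - 1 := by
  have hi := fun A : Set ℝ => (integrable_logRatio η (law η)).integrableOn (s := A)
  have hleft : ∫ x in Set.Iic 0, logRatio η x ∂law η = -η * (Real.exp (-η) / 2) := by
    rw [setIntegral_congr_fun measurableSet_Iic (g := fun _ => -η) (fun x hx => ?_),
      setIntegral_const, law_real_Iic hη, sub_zero, smul_eq_mul, mul_comm]
    have hx : x ≤ 0 := hx
    rw [logRatio, abs_of_nonpos hx, abs_of_nonpos (by linarith)]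
    ring
  have hright : ∫ x in Set.Ioi η, logRatio η x ∂law η = η / 2 := by
    rw [setIntegral_congr_fun measurableSet_Ioi (g := fun _ => η) (fun x hx => ?_),
      setIntegral_const, law_real_Ioi le_rfl, sub_self, neg_zero, Real.exp_zero, smul_eq_mul]
    · ring
    · have hx : η < x := hx
      rw [logRatio, abs_of_nonneg (by linarith), abs_of_nonneg (by linarith)]
      ring
  -- Here the log-ratio is `2 * x - η` and the density `exp (x - η) / 2`; the product has
  -- antiderivative `(x - η / 2 - 1) * exp (x - η)`.
  have hmid : ∫ x in Set.Ioc 0 η, logRatio η x ∂law η =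
      (η / 2 - 1) + (η / 2 + 1) * Real.exp (-η) := by
    rw [← integral_indicator measurableSet_Ioc, integral_law]
    have e : (fun x => density η x * (Set.Ioc 0 η).indicator (logRatio η) x) =
        (Set.Ioc 0 η).indicator fun x => (x - η / 2) * Real.exp (x - η) := by
      funext x
      by_cases hx : x ∈ Set.Ioc 0 η
      · rw [Set.indicator_of_mem hx, Set.indicator_of_mem hx, density, logRatio,
          abs_of_nonneg hx.1.le, abs_of_nonpos (by linarith [hx.2]), neg_neg]
        ring
      · rw [Set.indicator_of_notMem hx, Set.indicator_of_notMem hx, mul_zero]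
    rw [e, integral_indicator measurableSet_Ioc, ← intervalIntegral.integral_of_le hη,
      intervalIntegral.integral_eq_sub_of_hasDerivAt
        (f := fun x => (x - η / 2 - 1) * Real.exp (x - η)) (fun x _ => ?_)
        (Continuous.intervalIntegrable (by fun_prop) _ _)]
    · rw [sub_self, Real.exp_zero, zero_sub η]
      ring
    · have h1 : HasDerivAt (fun x : ℝ => x - η / 2 - 1) 1 x :=
        ((hasDerivAt_id x).sub_const _).sub_const _
      have h2 : HasDerivAt (fun x : ℝ => Real.exp (x - η)) (Real.exp (x - η) * 1) x :=
        ((hasDerivAt_id x).sub_const η).exp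
      refine (h1.mul h2).congr_deriv ?_
      ring
  rw [← setIntegral_univ, ← Set.Iic_union_Ioi (a := (0 : ℝ)),
    setIntegral_union (Set.Iic_disjoint_Ioi le_rfl) measurableSet_Ioi (hi _) (hi _),
    ← Set.Ioc_union_Ioi_eq_Ioi hη,
    setIntegral_union (Set.Ioc_disjoint_Ioi le_rfl) measurableSet_Ioi (hi _) (hi _),
    hleft, hmid, hright]
  ring

theorem klDiv_law_toReal {η : ℝ} (hη : 0 ≤ η) :
    (InformationTheory.klDiv (law η) (law 0)).toReal = Real.exp (-η) + η - 1 := by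
  rw [toReal_klDiv_eq_integral (continuous_logRatio η).measurable (law_eq_withDensity η),
    integral_logRatio_law hη]

theorem klDiv_law {η : ℝ} (hη : 0 ≤ η) :
    InformationTheory.klDiv (law η) (law 0) = ENNReal.ofReal (Real.exp (-η) + η - 1) := by
  rw [← klDiv_law_toReal hη, ENNReal.ofReal_toReal]
  exact klDiv_ne_top_of_integrable (continuous_logRatio η).measurable (law_eq_withDensity η)
    (integrable_logRatio η _)

end LaplaceLocation

namespace LaplaceLocation

/-! ### The sample median -/

variable {n : ℕ} {x : Fin n → ℝ}

theorem countIn_eq_card (S : Set ℝ) [DecidablePred (· ∈ S)] (x : Fin n → ℝ) :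
    countIn S x = (Finset.univ.filter fun i => x i ∈ S).card := by
  rw [countIn, Finset.card_filter]
  push_cast
  refine Finset.sum_congr rfl fun i _ => ?_
  by_cases h : x i ∈ S <;> simp [h]

/-- If a monotone rearrangement takes values in `S` at `k` indices, then `S` contains at least `k`
observations. -/
theorem card_le_countIn_of_sort {S : Set ℝ} (I : Finset (Fin n))
    (h : ∀ i ∈ I, x (Tuple.sort x i) ∈ S) : (I.card : ℝ) ≤ countIn S x := by
  classical
  rw [countIn_eq_card, Nat.cast_le]
  refine Finset.card_le_card_of_injOn (Tuple.sort x) (fun i hi => ?_)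
    ((Tuple.sort x).injective.injOn)
  simpa using h i hi

theorem countIn_add_compl (S : Set ℝ) (x : Fin n → ℝ) : countIn S x + countIn Sᶜ x = n := by
  rw [countIn, countIn, ← Finset.sum_add_distrib]
  have : ∀ y : ℝ, S.indicator (fun _ => (1 : ℝ)) y + Sᶜ.indicator (fun _ => (1 : ℝ)) y = 1 :=
    fun y => by by_cases h : y ∈ S <;> simp [h]
  simp [this]

/-- The upper middle order statistic is at least the median, hence so are the `n - n / 2` sorted
values from the zero-based index `n / 2` on. -/
theorem le_two_mul_countIn_Ici {s : ℝ} (h : s ≤ sampleMedian n x) :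
    (n : ℝ) ≤ 2 * countIn (Set.Ici s) x := by
  rcases Nat.eq_zero_or_pos n with rfl | hn
  · simp [countIn]
  have hmono : Monotone (x ∘ Tuple.sort x) := Tuple.monotone_sort x
  rw [sampleMedian, dif_pos hn] at h
  have h1 : x (Tuple.sort x ⟨(n - 1) / 2, by omega⟩) ≤ x (Tuple.sort x ⟨n / 2, by omega⟩) :=
    hmono (Fin.mk_le_mk.2 (by omega))
  have h2 := card_le_countIn_of_sort (x := x) (S := Set.Ici s)
    (Finset.Ici (⟨n / 2, by omega⟩ : Fin n)) (fun i hi => by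
      have : x (Tuple.sort x ⟨n / 2, by omega⟩) ≤ x (Tuple.sort x i) :=
        hmono (Finset.mem_Ici.1 hi)
      exact Set.mem_Ici.2 (by linarith))
  rw [Fin.card_Ici] at h2
  have h3 : (n : ℝ) ≤ 2 * (n - n / 2 : ℕ) := by
    have : n ≤ 2 * (n - n / 2) := by omega
    exact_mod_cast this
  simp only at h2
  linarith

theorem le_two_mul_countIn_Iic {s : ℝ} (h : sampleMedian n x ≤ s) :
    (n : ℝ) ≤ 2 * countIn (Set.Iic s) x := by
  rcases Nat.eq_zero_or_pos n with rfl | hn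
  · simp [countIn]
  have hmono : Monotone (x ∘ Tuple.sort x) := Tuple.monotone_sort x
  rw [sampleMedian, dif_pos hn] at h
  have h1 : x (Tuple.sort x ⟨(n - 1) / 2, by omega⟩) ≤ x (Tuple.sort x ⟨n / 2, by omega⟩) :=
    hmono (Fin.mk_le_mk.2 (by omega))
  have h2 := card_le_countIn_of_sort (x := x) (S := Set.Iic s)
    (Finset.Iic (⟨(n - 1) / 2, by omega⟩ : Fin n)) (fun i hi => by
      have : x (Tuple.sort x i) ≤ x (Tuple.sort x ⟨(n - 1) / 2, by omega⟩) :=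
        hmono (Finset.mem_Iic.1 hi)
      exact Set.mem_Iic.2 (by linarith))
  rw [Fin.card_Iic] at h2
  have h3 : (n : ℝ) ≤ 2 * ((n - 1) / 2 + 1 : ℕ) := by
    have : n ≤ 2 * ((n - 1) / 2 + 1) := by omega
    exact_mod_cast this
  simp only at h2
  linarith

/-- A strict majority forces even the lower middle order statistic up to `s`. For even `n` exactly
half would not do, since the lower middle value could be far below `s`. -/
theorem le_sampleMedian_of_lt {s : ℝ} (h : (n : ℝ) < 2 * countIn (Set.Ici s) x) :
    s ≤ sampleMedian n x := by
  rcases Nat.eq_zero_or_pos n with rfl | hn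
  · simp [countIn] at h
  have hmono : Monotone (x ∘ Tuple.sort x) := Tuple.monotone_sort x
  rw [sampleMedian, dif_pos hn]
  have h1 : x (Tuple.sort x ⟨(n - 1) / 2, by omega⟩) ≤ x (Tuple.sort x ⟨n / 2, by omega⟩) :=
    hmono (Fin.mk_le_mk.2 (by omega))
  suffices s ≤ x (Tuple.sort x ⟨(n - 1) / 2, by omega⟩) by linarith
  by_contra! hlt
  have h2 := card_le_countIn_of_sort (x := x) (S := (Set.Ici s)ᶜ)
    (Finset.Iic (⟨(n - 1) / 2, by omega⟩ : Fin n)) (fun i hi => by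
      have : x (Tuple.sort x i) ≤ x (Tuple.sort x ⟨(n - 1) / 2, by omega⟩) :=
        hmono (Finset.mem_Iic.1 hi)
      rw [Set.compl_Ici]
      exact Set.mem_Iio.2 (by linarith))
  rw [Fin.card_Iic] at h2
  have h3 : (n : ℝ) ≤ 2 * ((n - 1) / 2 + 1 : ℕ) := by
    have : n ≤ 2 * ((n - 1) / 2 + 1) := by omega
    exact_mod_cast this
  have h4 := countIn_add_compl (Set.Ici s) x
  simp only at h2
  linarith

/-- Moving `a` to the right does not decrease the sum of absolute deviations when at least half of
the observations are at most `a`. -/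
theorem sum_abs_sub_le_of_Iic {a b : ℝ} (hab : a ≤ b)
    (h : (n : ℝ) ≤ 2 * countIn (Set.Iic a) x) : ∑ i, |x i - a| ≤ ∑ i, |x i - b| := by
  -- An observation at most `a` gains exactly `b - a`; any other loses at most `b - a`.
  have h1 : ∀ y : ℝ, |y - a| + (b - a) * (2 * (Set.Iic a).indicator (fun _ => (1 : ℝ)) y - 1) ≤
      |y - b| := fun y => by
    by_cases hy : y ≤ a
    · rw [Set.indicator_of_mem (Set.mem_Iic.2 hy), abs_of_nonpos (by linarith),
        abs_of_nonpos (by linarith)]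
      linarith
    · rw [Set.indicator_of_notMem (by simpa using hy)]
      have := abs_sub_abs_le_abs_sub (y - a) (y - b)
      rw [show y - a - (y - b) = b - a by ring, abs_of_nonneg (sub_nonneg.2 hab)] at this
      linarith
  have h2 := Finset.sum_le_sum fun i (_ : i ∈ Finset.univ) => h1 (x i)
  rw [Finset.sum_add_distrib, ← Finset.mul_sum, Finset.sum_sub_distrib, ← Finset.mul_sum] at h2
  have h3 : 0 ≤ (b - a) * (2 * countIn (Set.Iic a) x - n) :=
    mul_nonneg (sub_nonneg.2 hab) (by linarith)
  simp only [countIn] at h3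
  simp only [Finset.sum_const, Finset.card_univ, Fintype.card_fin, nsmul_eq_mul, mul_one] at h2
  linarith

theorem sum_abs_sub_le_of_Ici {a b : ℝ} (hab : b ≤ a)
    (h : (n : ℝ) ≤ 2 * countIn (Set.Ici a) x) : ∑ i, |x i - a| ≤ ∑ i, |x i - b| := by
  have h1 : countIn (Set.Iic (-a)) (fun i => -x i) = countIn (Set.Ici a) x := by
    simp [countIn, Set.indicator_apply]
  have h2 := sum_abs_sub_le_of_Iic (x := fun i => -x i) (neg_le_neg hab) (by rwa [h1])
  have h3 : ∀ c y : ℝ, |-y - -c| = |y - c| := fun c y => by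
    rw [show -y - -c = -(y - c) by ring, abs_neg]
  simpa only [h3] using h2

/-- The estimator `mle` minimizes the sum of absolute deviations over `[0, ∞)`. -/
theorem sum_abs_sub_mle_le {η : ℝ} (hη : 0 ≤ η) (x : Fin n → ℝ) :
    ∑ i, |x i - mle n x| ≤ ∑ i, |x i - η| := by
  rcases le_total (mle n x) η with h | h
  · exact sum_abs_sub_le_of_Iic h (le_two_mul_countIn_Iic (le_max_right _ _))
  · rcases eq_or_lt_of_le h with h' | h'
    · rw [h']
    · refine sum_abs_sub_le_of_Ici h (le_two_mul_countIn_Ici ?_)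
      -- Exceeding `η ≥ 0` rules out truncation at `0`, so the estimator is the median itself.
      rcases max_choice 0 (sampleMedian n x) with h0 | h0
      · exact absurd (h'.trans_eq h0) hη.not_gt
      · exact h0.le

theorem logLrtStat_eq (n : ℕ) (x : Fin n → ℝ) :
    logLrtStat n x = ∑ i, logRatio (mle n x) (x i) := by
  rw [logLrtStat, lrtStat, Real.log_exp]
  simp only [logRatio, Finset.sum_sub_distrib]
  ring

theorem sum_logRatio_le_logLrtStat {η : ℝ} (hη : 0 ≤ η) (x : Fin n → ℝ) :
    ∑ i, logRatio η (x i) ≤ logLrtStat n x := by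
  rw [logLrtStat_eq]
  simp only [logRatio, Finset.sum_sub_distrib]
  linarith [sum_abs_sub_mle_le hη x]

/-- Each summand is 1-Lipschitz in the location. This serves both to replace the estimator by `θ` in
the law of large numbers and to discretize the supremum. -/
theorem abs_sum_logRatio_sub_le (η η' : ℝ) (x : Fin n → ℝ) :
    |∑ i, logRatio η (x i) - ∑ i, logRatio η' (x i)| ≤ n * |η - η'| := by
  rw [← Finset.sum_sub_distrib]
  refine (Finset.abs_sum_le_sum_abs _ _).trans ?_
  refine (Finset.sum_le_sum fun i _ => (?_ : _ ≤ |η - η'|)).trans (by simp)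
  have := abs_abs_sub_abs_le_abs_sub (x i - η') (x i - η)
  rw [sub_sub_sub_cancel_left] at this
  simpa [logRatio] using this

end LaplaceLocation

namespace LaplaceLocation

/-! ### Auxiliary facts on continuity, frequencies and positivity -/

theorem exists_gt_lt_of_continuousAt {f : ℝ → ℝ} {x b c : ℝ} (hf : ContinuousAt f x)
    (hb : x < b) (hc : f x < c) : ∃ y, x < y ∧ y < b ∧ f y < c := by
  have h1 : ∀ᶠ y in 𝓝[>] x, f y < c := (hf.eventually_lt_const hc).filter_mono nhdsWithin_le_nhds
  obtain ⟨y, hy1, hy2⟩ := (h1.and (Ioo_mem_nhdsGT hb)).exists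
  exact ⟨y, hy2.1, hy2.2, hy1⟩

theorem exists_lt_gt_of_continuousAt {f : ℝ → ℝ} {x b c : ℝ} (hf : ContinuousAt f x)
    (hb : b < x) (hc : c < f x) : ∃ y, b < y ∧ y < x ∧ c < f y := by
  have h1 : ∀ᶠ y in 𝓝[<] x, c < f y := (hf.eventually_const_lt hc).filter_mono nhdsWithin_le_nhds
  obtain ⟨y, hy1, hy2⟩ := (h1.and (Ioo_mem_nhdsLT hb)).exists
  exact ⟨y, hy2.1, hy2.2, hy1⟩

theorem half_exp_neg_mem_Ioo {s : ℝ} (hs : 0 ≤ s) : Real.exp (-s) / 2 ∈ Set.Ioo (0 : ℝ) 1 :=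
  ⟨by positivity, by linarith [Real.exp_le_one_iff.2 (neg_nonpos.2 hs)]⟩

theorem ae_tendsto_countIn_div (θ : ℝ) {S : Set ℝ} (hS : MeasurableSet S) :
    ∀ᵐ ω ∂seqLaw θ, Tendsto (fun n : ℕ => countIn S (firstObs n ω) / n) atTop
      (𝓝 ((law θ).real S)) := by
  rw [← integral_indicator_one_real hS]
  exact ae_tendsto_mean (measurable_const.indicator hS) (integrable_indicator_one hS (law θ))

theorem eventually_natCast_pos : ∀ᶠ n : ℕ in atTop, (0 : ℝ) < n :=
  (eventually_gt_atTop 0).mono fun _ h => Nat.cast_pos.2 h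

/-! ### The sign test -/

theorem posProb_eq {θ : ℝ} (hθ : 0 < θ) : (posProb θ : ℝ) = 1 - (1 / 2) * Real.exp (-θ) := by
  change (law θ).real (Set.Ioi 0) = _
  rw [law_real_Ioi_of_le hθ.le, sub_zero]
  ring

theorem posProb_mem_Ioo {θ : ℝ} (hθ : 0 < θ) : (posProb θ : ℝ) ∈ Set.Ioo (1 / 2 : ℝ) 1 := by
  rw [posProb_eq hθ]
  have h1 := Real.exp_pos (-θ)
  have h2 : Real.exp (-θ) < 1 := Real.exp_lt_one_iff.2 (by linarith)
  constructor <;> linarith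

theorem ae_tendsto_signStat (θ : ℝ) :
    ∀ᵐ ω ∂seqLaw θ, Tendsto (fun n : ℕ => signStat n (firstObs n ω) / n) atTop
      (𝓝 (posProb θ)) :=
  ae_tendsto_countIn_div θ measurableSet_Ioi

theorem isBahadurSlope_signStat {θ : ℝ} (hθ : 0 < θ) :
    IsBahadurSlope signStat θ (2 * binKL (posProb θ) (1 / 2)) := by
  obtain ⟨hp1, hp2⟩ := posProb_mem_Ioo hθ
  have hq : (1 / 2 : ℝ) ∈ Set.Ioo (0 : ℝ) 1 := by norm_num
  have hμ : (law 0).real (Set.Ioi 0) = 1 / 2 := by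
    rw [law_real_Ioi le_rfl, sub_self, neg_zero, Real.exp_zero]
  have hcont : ContinuousAt (fun p : ℝ => binKL p (1 / 2)) (posProb θ) :=
    (continuousAt_binKL (x := ((posProb θ : ℝ), 1 / 2)) ⟨by linarith, hp2⟩ hq).comp
      (f := fun p : ℝ => (p, (1 / 2 : ℝ))) (by fun_prop)
  refine isBahadurSlope_of_tail_bounds (L := posProb θ) (by linarith) eventually_natCast_pos
    (ae_tendsto_signStat θ) (fun ε hε => ?_) (fun ε hε => ?_)
  · obtain ⟨p, h1, h2, h3⟩ := exists_gt_lt_of_continuousAt hcont hp2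
      (show _ < binKL (posProb θ) (1 / 2) + ε / 2 by simp [hε])
    -- The level must exceed the limit `posProb θ` yet stay below the mean `p` of the tilted law;
    -- the midpoint does both.
    refine ⟨(posProb θ + p) / 2, by linarith, ?_⟩
    filter_upwards [eventually_exp_le_pi_real_countIn_ge measurableSet_Ioi
      ⟨by linarith, h2⟩ hq (law 0) hμ (show ((posProb θ : ℝ) + p) / 2 < p by linarith)
      (half_pos hε)] with n hn
    refine le_trans (Real.exp_le_exp.2 (neg_le_neg ?_)) hn
    exact mul_le_mul_of_nonneg_left (by linarith) n.cast_nonneg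
  · obtain ⟨p, h1, h2, h3⟩ := exists_lt_gt_of_continuousAt hcont hp1
      (show binKL (posProb θ) (1 / 2) - ε < _ by simp [hε])
    refine ⟨p, h2, Eventually.of_forall fun n => ?_⟩
    refine (pi_real_countIn_ge_le measurableSet_Ioi ⟨by linarith, by linarith⟩ hq h1.le (law 0) hμ
      n).trans (Real.exp_le_exp.2 (neg_le_neg ?_))
    exact mul_le_mul_of_nonneg_left (by linarith) n.cast_nonneg

/-! ### The median test -/

theorem ae_tendsto_sampleMedian (θ : ℝ) :
    ∀ᵐ ω ∂seqLaw θ, Tendsto (fun n : ℕ => sampleMedian n (firstObs n ω)) atTop (𝓝 θ) := by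
  -- Countably many tolerances, so that the exceptional null sets can be united.
  have h : ∀ k : ℕ, ∀ᵐ ω ∂seqLaw θ, ∀ᶠ n : ℕ in atTop,
      |sampleMedian n (firstObs n ω) - θ| ≤ 1 / ((k : ℝ) + 1) := fun k => by
    set ε : ℝ := 1 / ((k : ℝ) + 1)
    have hε : 0 < ε := by positivity
    have he : Real.exp (-ε) < 1 := Real.exp_lt_one_iff.2 (by linarith)
    have hup : (law θ).real (Set.Ici (θ + ε)) < 1 / 2 := by
      rw [law_real_Ici (by linarith), add_sub_cancel_left]; linarith
    have hlow : 1 / 2 < (law θ).real (Set.Ici (θ - ε)) := by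
      rw [law_real_Ici_of_le (by linarith), sub_sub_cancel]; linarith
    filter_upwards [ae_tendsto_countIn_div θ (measurableSet_Ici (a := θ + ε)),
      ae_tendsto_countIn_div θ (measurableSet_Ici (a := θ - ε))] with ω h1 h2
    filter_upwards [h1.eventually_lt_const hup, h2.eventually_const_lt hlow,
      eventually_natCast_pos] with n h3 h4 hn
    rw [div_lt_iff₀ hn] at h3
    rw [lt_div_iff₀ hn] at h4
    have h5 : sampleMedian n (firstObs n ω) < θ + ε := by
      by_contra! hc
      linarith [le_two_mul_countIn_Ici hc]
    have h6 := le_sampleMedian_of_lt (x := firstObs n ω) (s := θ - ε) (by linarith)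
    rw [abs_le]
    constructor <;> linarith
  filter_upwards [ae_all_iff.2 h] with ω hω
  rw [Metric.tendsto_nhds]
  intro ε hε
  obtain ⟨k, hk⟩ := exists_nat_one_div_lt hε
  filter_upwards [hω k] with n hn
  exact hn.trans_lt hk

theorem two_mul_binKL_half {s : ℝ} (hs : 0 ≤ s) :
    2 * binKL (1 / 2) (Real.exp (-s) / 2) = s - Real.log (2 - Real.exp (-s)) := by
  have h1 : Real.exp (-s) ≤ 1 := Real.exp_le_one_iff.2 (neg_nonpos.2 hs)
  have h2 : (1 / 2 : ℝ) / (Real.exp (-s) / 2) = Real.exp s := by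
    rw [Real.exp_neg]; field_simp
  have h4 : (1 - 1 / 2 : ℝ) / (1 - Real.exp (-s) / 2) = (2 - Real.exp (-s))⁻¹ := by
    have : 2 - Real.exp (-s) ≠ 0 := by linarith
    have : 1 - Real.exp (-s) / 2 ≠ 0 := by linarith
    field_simp
    norm_num
  rw [binKL, h2, h4, Real.log_exp, Real.log_inv]
  ring

theorem nullTail_sampleMedian_le {s : ℝ} (hs : 0 ≤ s) (n : ℕ) :
    nullTail sampleMedian n s ≤ Real.exp (-(n * binKL (1 / 2) (Real.exp (-s) / 2))) := by
  have hμ : (law 0).real (Set.Ici s) = Real.exp (-s) / 2 := by rw [law_real_Ici hs, sub_zero]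
  refine le_trans (measureReal_mono fun x hx => ?_)
    (pi_real_countIn_ge_le measurableSet_Ici (by norm_num) (half_exp_neg_mem_Ioo hs)
      (by linarith [Real.exp_le_one_iff.2 (neg_nonpos.2 hs)]) (law 0) hμ n)
  have := le_two_mul_countIn_Ici (show s ≤ sampleMedian n x from hx)
  rw [Set.mem_ofPred_eq]
  linarith

theorem isBahadurSlope_sampleMedian {θ : ℝ} (hθ : 0 < θ) :
    IsBahadurSlope sampleMedian θ (2 * binKL (1 / 2) (Real.exp (-θ) / 2)) := by
  have hhalf : (1 / 2 : ℝ) ∈ Set.Ioo (0 : ℝ) 1 := by norm_num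
  have hcont : ContinuousAt (fun s : ℝ => binKL (1 / 2) (Real.exp (-s) / 2)) θ :=
    (continuousAt_binKL (x := (1 / 2, Real.exp (-θ) / 2)) hhalf
      (half_exp_neg_mem_Ioo hθ.le)).comp (f := fun s : ℝ => ((1 / 2 : ℝ), Real.exp (-s) / 2))
      (by fun_prop)
  refine isBahadurSlope_of_tail_bounds (a := fun _ => 1) hθ.ne'
    (Eventually.of_forall fun _ => one_pos) ?_ (fun ε hε => ?_) (fun ε hε => ?_)
  · simpa only [div_one] using ae_tendsto_sampleMedian θ
  · obtain ⟨s, h1, -, h3⟩ := exists_gt_lt_of_continuousAt hcont (lt_add_one θ)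
      (show _ < binKL (1 / 2) (Real.exp (-θ) / 2) + ε / 3 by simp [hε])
    have hs : 0 ≤ s := by linarith
    have hq := half_exp_neg_mem_Ioo hs
    have hμ : (law 0).real (Set.Ici s) = Real.exp (-s) / 2 := by rw [law_real_Ici hs, sub_zero]
    have hcont' : ContinuousAt (fun p : ℝ => binKL p (Real.exp (-s) / 2)) (1 / 2) :=
      (continuousAt_binKL (x := (1 / 2, Real.exp (-s) / 2)) hhalf hq).comp
        (f := fun p : ℝ => (p, Real.exp (-s) / 2)) (by fun_prop)
    -- A second perturbation, from `1 / 2` to `p`, makes a strict majority typical under the tilt.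
    -- Moving `θ` to `s`, moving `1 / 2` to `p`, and the change of measure cost `ε / 3` each.
    obtain ⟨p, h4, h5, h6⟩ := exists_gt_lt_of_continuousAt hcont' one_half_lt_one
      (show _ < binKL (1 / 2) (Real.exp (-s) / 2) + ε / 3 by simp [hε])
    refine ⟨s, h1, ?_⟩
    filter_upwards [eventually_exp_le_pi_real_countIn_ge measurableSet_Ici
      ⟨by linarith, h5⟩ hq (law 0) hμ (show (1 / 2 + p) / 2 < p by linarith)
      (show 0 < ε / 3 by linarith), eventually_natCast_pos] with n hn hn0
    refine le_trans (Real.exp_le_exp.2 (neg_le_neg ?_)) (hn.trans (measureReal_mono fun x hx => ?_))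
    · exact mul_le_mul_of_nonneg_left (by linarith) n.cast_nonneg
    · have hx' : (n : ℝ) * ((1 / 2 + p) / 2) ≤ countIn (Set.Ici s) x := hx
      rw [Set.mem_ofPred_eq, one_mul]
      refine le_sampleMedian_of_lt (lt_of_lt_of_le ?_ (mul_le_mul_of_nonneg_left hx' two_pos.le))
      nlinarith
  · obtain ⟨s, h1, h2, h3⟩ := exists_lt_gt_of_continuousAt hcont hθ
      (show binKL (1 / 2) (Real.exp (-θ) / 2) - ε < _ by simp [hε])
    refine ⟨s, h2, Eventually.of_forall fun n => ?_⟩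
    rw [one_mul]
    refine (nullTail_sampleMedian_le h1.le n).trans (Real.exp_le_exp.2 (neg_le_neg ?_))
    exact mul_le_mul_of_nonneg_left (by linarith) n.cast_nonneg

/-- One application of l'Hôpital's rule leaves `(1 - exp (-θ)) / (θ * (2 - exp (-θ)))`, whose limit
is read off the derivative of `exp (-θ)` at `0`. -/
theorem isEquivalent_medianSlope :
    (fun θ : ℝ => 2 * binKL (1 / 2) (Real.exp (-θ) / 2)) ~[𝓝[>] 0] (fun θ => θ ^ 2) := by
  have hev : (fun θ : ℝ => θ - Real.log (2 - Real.exp (-θ))) =ᶠ[𝓝[>] 0]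
      fun θ : ℝ => 2 * binKL (1 / 2) (Real.exp (-θ) / 2) := by
    filter_upwards [self_mem_nhdsWithin] with θ hθ
    exact (two_mul_binKL_half (le_of_lt hθ)).symm
  refine IsEquivalent.congr_left ?_ hev
  have hpos : ∀ θ : ℝ, 0 < θ → 0 < 2 - Real.exp (-θ) := fun θ hθ => by
    linarith [Real.exp_lt_one_iff.2 (show -θ < 0 by linarith)]
  rw [isEquivalent_iff_tendsto_one (by
    filter_upwards [self_mem_nhdsWithin] with θ hθ
    exact pow_ne_zero 2 (ne_of_gt hθ))]
  have hexp : ∀ θ : ℝ, HasDerivAt (fun θ : ℝ => Real.exp (-θ)) (-Real.exp (-θ)) θ := fun θ => by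
    simpa using (hasDerivAt_neg θ).exp
  refine HasDerivAt.lhopital_zero_nhdsGT
    (f' := fun θ => 1 - Real.exp (-θ) / (2 - Real.exp (-θ))) (g' := fun θ => 2 * θ) ?_ ?_ ?_ ?_ ?_ ?_
  · filter_upwards [self_mem_nhdsWithin] with θ hθ
    have h1 := ((hexp θ).const_sub 2).log (hpos θ hθ).ne'
    rw [neg_neg] at h1
    exact (hasDerivAt_id θ).sub h1
  · exact Eventually.of_forall fun θ => by simpa using hasDerivAt_pow 2 θ
  · filter_upwards [self_mem_nhdsWithin] with θ hθ
    exact mul_ne_zero two_ne_zero (ne_of_gt hθ)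
  · have : ContinuousAt (fun θ : ℝ => θ - Real.log (2 - Real.exp (-θ))) 0 :=
      continuousAt_id.sub (ContinuousAt.log (by fun_prop) (by norm_num))
    simpa [ContinuousAt, show (2 - 1 : ℝ) = 1 by norm_num] using
      this.tendsto.mono_left (nhdsWithin_le_nhds (s := Set.Ioi 0))
  · have : Continuous fun θ : ℝ => θ ^ 2 := by fun_prop
    simpa using (this.tendsto 0).mono_left (nhdsWithin_le_nhds (s := Set.Ioi 0))
  · have h1 : Tendsto (fun θ : ℝ => θ⁻¹ * (Real.exp (-θ) - 1)) (𝓝[>] 0) (𝓝 (-1)) := by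
      have := (hasDerivAt_iff_tendsto_slope.1 (hexp 0)).mono_left
        (nhdsWithin_mono (s := Set.Ioi 0) 0 fun x (hx : 0 < x) => ne_of_gt hx)
      simpa [slope_fun_def] using this
    have h2 : Tendsto (fun θ : ℝ => 2 - Real.exp (-θ)) (𝓝[>] 0) (𝓝 1) := by
      have : Continuous fun θ : ℝ => 2 - Real.exp (-θ) := by fun_prop
      simpa [show (2 - 1 : ℝ) = 1 by norm_num] using
        (this.tendsto 0).mono_left (nhdsWithin_le_nhds (s := Set.Ioi 0))
    have h3 := h1.neg.div h2 one_ne_zero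
    rw [neg_neg, div_one] at h3
    refine h3.congr' ?_
    filter_upwards [self_mem_nhdsWithin] with θ hθ
    have h4 := (hpos θ hθ).ne'
    have h5 : θ ≠ 0 := ne_of_gt hθ
    simp only [Pi.div_apply]
    field_simp
    ring

/-! ### The likelihood ratio test -/

/-- The Kullback-Leibler divergence between the Laplace laws with locations `θ ≥ 0` and `0`. -/
noncomputable def laplaceKL (θ : ℝ) : ℝ := Real.exp (-θ) + θ - 1

theorem laplaceKL_pos {θ : ℝ} (hθ : θ ≠ 0) : 0 < laplaceKL θ := by
  have := Real.add_one_lt_exp (neg_ne_zero.2 hθ)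
  unfold laplaceKL; linarith

/-- The tangent bound for `exp` makes the increment at least `(θ' - θ) * (1 - exp (-θ))`. -/
theorem laplaceKL_lt {θ θ' : ℝ} (hθ : 0 < θ) (h : θ < θ') : laplaceKL θ < laplaceKL θ' := by
  have h1 : Real.exp (-θ') = Real.exp (-θ) * Real.exp (-(θ' - θ)) := by
    rw [← Real.exp_add]; ring_nf
  have h2 := Real.add_one_le_exp (-(θ' - θ))
  have h3 := mul_le_mul_of_nonneg_left h2 (Real.exp_pos (-θ)).le
  have h4 : Real.exp (-θ) < 1 := Real.exp_lt_one_iff.2 (by linarith)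
  unfold laplaceKL
  rw [h1]
  nlinarith

theorem ae_tendsto_logLrtStat {θ : ℝ} (hθ : 0 < θ) :
    ∀ᵐ ω ∂seqLaw θ, Tendsto (fun n : ℕ => logLrtStat n (firstObs n ω) / n) atTop
      (𝓝 (laplaceKL θ)) := by
  have hmean := ae_tendsto_mean (continuous_logRatio θ).measurable (integrable_logRatio θ (law θ))
  rw [integral_logRatio_law hθ.le] at hmean
  filter_upwards [hmean, ae_tendsto_sampleMedian θ] with ω h1 h2
  have h3 : Tendsto (fun n : ℕ => |mle n (firstObs n ω) - θ|) atTop (𝓝 0) := by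
    have := ((tendsto_const_nhds (x := (0 : ℝ))).max h2).sub_const θ
    rw [max_eq_right hθ.le, sub_self] at this
    simpa [mle] using this.abs
  have h4 : Tendsto (fun n : ℕ => logLrtStat n (firstObs n ω) / n -
      (∑ i, logRatio θ (firstObs n ω i)) / n) atTop (𝓝 0) := by
    refine squeeze_zero_norm' ?_ h3
    filter_upwards [eventually_natCast_pos] with n hn
    rw [← sub_div, Real.norm_eq_abs, abs_div, abs_of_pos hn, div_le_iff₀ hn, mul_comm,
      logLrtStat_eq]
    exact abs_sum_logRatio_sub_le _ _ _
  have h5 := h4.add h1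
  rw [zero_add] at h5
  exact h5.congr fun n => by ring

/-- If the median is below `R`, rounding the estimator down to the grid of mesh `δ` costs at most `n
* δ`; each grid point then obeys Markov's bound, whose exponent does not depend on the location. -/
theorem nullTail_logLrtStat_le {R δ : ℝ} (hR : 0 ≤ R) (hδ : 0 < δ) (s : ℝ) (n : ℕ) :
    nullTail logLrtStat n (n * s) ≤
      Real.exp (-(n * binKL (1 / 2) (Real.exp (-R) / 2))) +
        (⌊R / δ⌋₊ + 1 : ℕ) * Real.exp (-(n * (s - δ))) := by
  have hsub : {x : Fin n → ℝ | n * s ≤ logLrtStat n x} ⊆ {x | R ≤ sampleMedian n x} ∪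
      ⋃ k ∈ Finset.range (⌊R / δ⌋₊ + 1), {x | n * (s - δ) ≤ ∑ i, logRatio (k * δ) (x i)} := by
    intro x hx
    have hx' : n * s ≤ logLrtStat n x := hx
    rcases le_or_gt R (sampleMedian n x) with h | h
    · exact Or.inl h
    · right
      have h0 : 0 ≤ mle n x := le_max_left _ _
      have hle : mle n x ≤ R := max_le hR h.le
      have hk := Nat.floor_le (div_nonneg h0 hδ.le)
      have hk' := Nat.lt_floor_add_one (mle n x / δ)
      rw [le_div_iff₀ hδ] at hk
      rw [div_lt_iff₀ hδ] at hk'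
      refine Set.mem_biUnion (x := ⌊mle n x / δ⌋₊) ?_ ?_
      · rw [Finset.coe_range, Set.mem_Iio, Nat.lt_succ_iff]
        exact Nat.floor_le_floor (by gcongr)
      · have h1 := (abs_le.1 (abs_sum_logRatio_sub_le (mle n x) (⌊mle n x / δ⌋₊ * δ) x)).2
        rw [← logLrtStat_eq] at h1
        have h2 : n * |mle n x - ⌊mle n x / δ⌋₊ * δ| ≤ n * δ := by
          refine mul_le_mul_of_nonneg_left ?_ n.cast_nonneg
          rw [abs_le]
          constructor <;> linarith
        rw [Set.mem_ofPred_eq]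
        linarith
  refine (measureReal_mono hsub).trans ((measureReal_union_le _ _).trans
    (add_le_add (nullTail_sampleMedian_le hR n) ?_))
  refine (measureReal_biUnion_finset_le _ _).trans ((Finset.sum_le_sum fun (k : ℕ) _ =>
    pi_real_sum_ge_le_exp (continuous_logRatio (k * δ)).measurable (law_eq_withDensity _) n (n * (s - δ))).trans
      ?_)
  simp

theorem isBahadurSlope_logLrtStat {θ : ℝ} (hθ : 0 < θ) :
    IsBahadurSlope logLrtStat θ (2 * laplaceKL θ) := by
  have hK := laplaceKL_pos hθ.ne'
  refine isBahadurSlope_of_tail_bounds hK.ne' eventually_natCast_pos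
    (ae_tendsto_logLrtStat hθ) (fun ε hε => ?_) (fun ε hε => ?_)
  · have hcont : ContinuousAt laplaceKL θ := by unfold laplaceKL; fun_prop
    obtain ⟨η, h1, -, h3⟩ := exists_gt_lt_of_continuousAt hcont (lt_add_one θ)
      (show _ < laplaceKL θ + ε / 2 by simp [hε])
    have h0 : 0 ≤ η := by linarith
    have h4 := laplaceKL_lt hθ h1
    -- With location `η` as the tilt, the tilting log-density and the statistic being averaged
    -- coincide, so this one number is both the mean and the cost.
    have h5 : ∫ x, logRatio η x ∂law η = laplaceKL η := integral_logRatio_law h0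
    refine ⟨(laplaceKL θ + laplaceKL η) / 2, by linarith, ?_⟩
    have h6 := eventually_exp_le_pi_real_sum_ge (continuous_logRatio η).measurable
      (law_eq_withDensity η) (integrable_logRatio η _) (continuous_logRatio η).measurable
      (integrable_logRatio η _)
      (show (laplaceKL θ + laplaceKL η) / 2 < ∫ x, logRatio η x ∂law η by linarith) (half_pos hε)
    filter_upwards [h6] with n hn
    rw [h5] at hn
    refine le_trans (Real.exp_le_exp.2 (neg_le_neg ?_)) (hn.trans (measureReal_mono fun x hx => ?_))
    · exact mul_le_mul_of_nonneg_left (by linarith) n.cast_nonneg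
    · exact le_trans hx (sum_logRatio_le_logLrtStat h0 x)
  · refine ⟨laplaceKL θ - ε / 4, by linarith, ?_⟩
    -- Since `log (2 - exp (-R)) ≤ 1`, twice the median rate at `R` is at least `R - 1 = 2 *
    -- laplaceKL θ`, so the truncation term is no larger than the main one.
    set R := 2 * laplaceKL θ + 1 with hRdef
    have hR : 0 ≤ R := by linarith
    have hB : laplaceKL θ ≤ binKL (1 / 2) (Real.exp (-R) / 2) := by
      have h1 := two_mul_binKL_half hR
      have h2 : Real.exp (-R) ≤ 1 := Real.exp_le_one_iff.2 (neg_nonpos.2 hR)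
      have h3 := Real.log_le_sub_one_of_pos (show 0 < 2 - Real.exp (-R) by linarith)
      have h4 := Real.exp_pos (-R)
      linarith
    set N : ℕ := ⌊R / (ε / 4)⌋₊ + 1
    -- The union bound has `N` grid terms and one truncation term; `N` is free of `n`, so half of
    -- `ε` absorbs the factor `N + 1`.
    have hbig : ∀ᶠ n : ℕ in atTop, Real.log (N + 1) ≤ n * (ε / 2) :=
      (tendsto_natCast_atTop_atTop.atTop_mul_const (by positivity)).eventually_ge_atTop _
    filter_upwards [hbig] with n hn
    have hN : (0 : ℝ) < N + 1 := by positivity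
    refine (nullTail_logLrtStat_le hR (show 0 < ε / 4 by linarith) _ n).trans ?_
    have h1 : Real.exp (-(n * binKL (1 / 2) (Real.exp (-R) / 2))) ≤
        Real.exp (-(n * (laplaceKL θ - ε / 2))) :=
      Real.exp_le_exp.2 (neg_le_neg (mul_le_mul_of_nonneg_left (by linarith) n.cast_nonneg))
    have h2 : laplaceKL θ - ε / 4 - ε / 4 = laplaceKL θ - ε / 2 := by ring
    rw [h2]
    calc _ ≤ Real.exp (-(n * (laplaceKL θ - ε / 2))) +
          N * Real.exp (-(n * (laplaceKL θ - ε / 2))) := by gcongr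
      _ = Real.exp (Real.log (N + 1) + -(n * (laplaceKL θ - ε / 2))) := by
        rw [Real.exp_add, Real.exp_log hN]; ring
      _ ≤ _ := Real.exp_le_exp.2 (by linarith)

end LaplaceLocation

theorem proposition5 :
    -- sign test
    (∀ θ : ℝ, 0 < θ →
      (LaplaceLocation.posProb θ : ℝ) = 1 - (1 / 2) * Real.exp (-θ) ∧
      LaplaceLocation.IsTypicalLevel LaplaceLocation.signStat θ
        (fun n => n * (LaplaceLocation.posProb θ : ℝ)) ∧
      InformationTheory.klDiv (LaplaceLocation.ber (LaplaceLocation.posProb θ))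
        (LaplaceLocation.ber ⟨1 / 2, by norm_num, by norm_num⟩) ≠ ∞ ∧
      LaplaceLocation.IsBahadurSlope LaplaceLocation.signStat θ
        (2 * (InformationTheory.klDiv (LaplaceLocation.ber (LaplaceLocation.posProb θ))
          (LaplaceLocation.ber ⟨1 / 2, by norm_num, by norm_num⟩)).toReal)) ∧
    -- median test
    (∃ cMed : ℝ → ℝ,
      (∀ θ : ℝ, 0 < θ →
        LaplaceLocation.IsTypicalLevel LaplaceLocation.sampleMedian θ (fun _ => θ) ∧
        LaplaceLocation.IsBahadurSlope LaplaceLocation.sampleMedian θ (cMed θ)) ∧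
      cMed ~[𝓝[>] 0] (fun θ => θ ^ 2)) ∧
    -- likelihood ratio test
    (∀ θ : ℝ, 0 < θ →
      InformationTheory.klDiv (LaplaceLocation.law θ) (LaplaceLocation.law 0) =
        ENNReal.ofReal (Real.exp (-θ) + θ - 1) ∧
      LaplaceLocation.IsTypicalLevel LaplaceLocation.logLrtStat θ
        (fun n => n * (InformationTheory.klDiv (LaplaceLocation.law θ)
          (LaplaceLocation.law 0)).toReal) ∧
      LaplaceLocation.IsBahadurSlope LaplaceLocation.logLrtStat θ
        (2 * (InformationTheory.klDiv (LaplaceLocation.law θ) (LaplaceLocation.law 0)).toReal) ∧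
      2 * (InformationTheory.klDiv (LaplaceLocation.law θ) (LaplaceLocation.law 0)).toReal =
        2 * (Real.exp (-θ) + θ - 1)) := by
  have hhalf : (1 / 2 : ℝ) ∈ Set.Ioo (0 : ℝ) 1 := by norm_num
  refine ⟨fun θ hθ => ?_, ⟨fun θ => 2 * LaplaceLocation.binKL (1 / 2) (Real.exp (-θ) / 2), fun θ hθ => ⟨?_,
    LaplaceLocation.isBahadurSlope_sampleMedian hθ⟩, LaplaceLocation.isEquivalent_medianSlope⟩, fun θ hθ => ?_⟩
  · have hp : (LaplaceLocation.posProb θ : ℝ) ∈ Set.Ioo (0 : ℝ) 1 :=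
      ⟨by linarith [(LaplaceLocation.posProb_mem_Ioo hθ).1], (LaplaceLocation.posProb_mem_Ioo hθ).2⟩
    refine ⟨LaplaceLocation.posProb_eq hθ, LaplaceLocation.isTypicalLevel_of_ae_tendsto hp.1.ne' (LaplaceLocation.ae_tendsto_signStat θ),
      LaplaceLocation.klDiv_ber_ne_top hp hhalf, ?_⟩
    rw [LaplaceLocation.toReal_klDiv_ber hp hhalf]
    exact LaplaceLocation.isBahadurSlope_signStat hθ
  · have := LaplaceLocation.isTypicalLevel_of_ae_tendsto (T := LaplaceLocation.sampleMedian) (a := fun _ => 1) hθ.ne'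
      (by simpa only [div_one] using LaplaceLocation.ae_tendsto_sampleMedian θ)
    simpa only [one_mul] using this
  · rw [LaplaceLocation.klDiv_law_toReal hθ.le]
    exact ⟨LaplaceLocation.klDiv_law hθ.le,
      LaplaceLocation.isTypicalLevel_of_ae_tendsto (LaplaceLocation.laplaceKL_pos hθ.ne').ne' (LaplaceLocation.ae_tendsto_logLrtStat hθ),
      LaplaceLocation.isBahadurSlope_logLrtStat hθ, rfl⟩
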